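/- All rings are commutative and all modules are finitely generated. Let $T$ be a Noetherian ring that is an algebra over a local ring, let $f\in T$ be a nonzerodivisor, put $R=T/(f)$, and let $M$ be an $R$-module. An $R$-module $L$ is called liftable to $T$ if there is a $T$-module $L'$ with $L'\otimes_T R\cong L$ and $\operatorname{Tor}_i^T(L',R)=0$ for all $i>0$; $M$ is called weakly liftable to $T$ if it is a direct summand of an $R$-module that is liftable to $T$. Choose any surjection $\pi: T^a\to M$ of $T$-modules, let $W=\operatorname{syz}_1^T M=\ker\pi$, and let $\theta: M\to W/fW$ be the $R$-linear map $\theta(\pi(x))=fx+fW$. For an $R$-module $N$ and $i\ge 0$ let $$\alpha_i:\operatorname{Tor}_{i+2}^R(M,N)\to\operatorname{Tor}_i^R(M,N)$$ be the connecting map of the change-of-rings long exact sequence $$\cdots\to\operatorname{Tor}_{i+2}^T(M,N)\to\operatorname{Tor}_{i+2}^R(M,N)\xrightarrow{\ \alpha_i\ }\operatorname{Tor}_i^R(M,N)\to\operatorname{Tor}_{i+1}^T(M,N)\to\cdots .$$ Then the following are equivalent: 1. $M$ is weakly liftable to $T$; 2. $\theta: M\to W/fW$ is a split monomorphism of $R$-modules,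 i.e. there is an $R$-linear map $\rho: W/fW\to M$ with $\rho\circ\theta=\mathrm{id}_M$; 3. for every $R$-module $N$, the map $\alpha_0:\operatorname{Tor}_2^R(M,N)\to\operatorname{Tor}_0^R(M,N)$ is zero; 4. for every $R$-module $N$ and every integer $i\ge 0$, the map $\alpha_i:\operatorname{Tor}_{i+2}^R(M,N)\to\operatorname{Tor}_i^R(M,N)$ is zero. -/

import Mathlib

universe u

noncomputable section

open CategoryTheory MonoidalCategory
open scoped Pointwise

/-! ### Liftable and weakly liftable modules -/

section Lifting

variable (T R : Type u) [CommRing T] [CommRing R] [Algebra T R]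

/-- An `R`-module `L` lifts to `T` if there is a finitely generated `T`-module `L'` with
`R ⊗[T] L' ≅ L` as `R`-modules and `Tor_i^T(L', R) = 0` for all `i > 0`. -/
def IsLiftable (L : Type u) [AddCommGroup L] [Module R L] : Prop :=
  ∃ (L' : Type u) (_ : AddCommGroup L') (_ : Module T L'), Module.Finite T L' ∧
    Nonempty ((TensorProduct T R L') ≃ₗ[R] L) ∧
    ∀ i : ℕ, 0 < i → Limits.IsZero
      (((Tor (ModuleCat.{u} T) i).obj (ModuleCat.of T L')).obj (ModuleCat.of T R))

/-- An `R`-module is weakly liftable to `T` if it is a direct summand of a finitely generated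
`R`-module that lifts to `T`. -/
def IsWeaklyLiftable (M : Type u) [AddCommGroup M] [Module R M] : Prop :=
  ∃ (L : Type u) (_ : AddCommGroup L) (_ : Module R L), Module.Finite R L ∧
    IsLiftable T R L ∧
    ∃ (j : M →ₗ[R] L) (q : L →ₗ[R] M), q ∘ₗ j = LinearMap.id

end Lifting

/-! ### The connecting maps of the long exact `Tor` sequence -/

namespace TorConnecting

variable {R : Type u} [CommRing R]

/-- A short exact sequence `0 → X₁ → X₂ → X₃ → 0` tensored with the projective resolution of `N`
by which `Tor` is computed. -/
def complexes (S : ShortComplex (ModuleCat.{u} R)) (N : ModuleCat.{u} R) :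
    ShortComplex (ChainComplex (ModuleCat.{u} R) ℕ) where
  X₁ := (((tensoringLeft (ModuleCat.{u} R)).obj S.X₁).mapHomologicalComplex _).obj
    (projectiveResolution N).complex
  X₂ := (((tensoringLeft (ModuleCat.{u} R)).obj S.X₂).mapHomologicalComplex _).obj
    (projectiveResolution N).complex
  X₃ := (((tensoringLeft (ModuleCat.{u} R)).obj S.X₃).mapHomologicalComplex _).obj
    (projectiveResolution N).complex
  f := (NatTrans.mapHomologicalComplex ((tensoringLeft (ModuleCat.{u} R)).map S.f) _).app _
  g := (NatTrans.mapHomologicalComplex ((tensoringLeft (ModuleCat.{u} R)).map S.g) _).app _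
  zero := by
    ext n : 1
    change (S.f ▷ _) ≫ (S.g ▷ _) = 0
    rw [← comp_whiskerRight, S.zero]
    exact MonoidalPreadditive.zero_whiskerRight

theorem complexes_shortExact {S : ShortComplex (ModuleCat.{u} R)} (hS : S.ShortExact)
    (N : ModuleCat.{u} R) : (complexes S N).ShortExact := by
  refine HomologicalComplex.shortExact_of_degreewise_shortExact _ fun n => ?_
  have hp : Projective ((projectiveResolution N).complex.X n) := inferInstance
  have : Module.Projective R ((projectiveResolution N).complex.X n) :=
    (IsProjective.iff_projective _).2 hp
  exact hS.map_of_exact (tensorRight ((projectiveResolution N).complex.X n))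

/-- The connecting map `Tor_{n+1}^R(X₃, N) → Tor_n^R(X₁, N)` of a short exact sequence
`0 → X₁ → X₂ → X₃ → 0` of `R`-modules. -/
def torδ {S : ShortComplex (ModuleCat.{u} R)} (hS : S.ShortExact) (N : ModuleCat.{u} R) (n : ℕ) :
    ((Tor (ModuleCat.{u} R) (n + 1)).obj S.X₃).obj N ⟶
      ((Tor (ModuleCat.{u} R) n).obj S.X₁).obj N :=
  ((projectiveResolution N).isoLeftDerivedObj
      ((tensoringLeft (ModuleCat.{u} R)).obj S.X₃) (n + 1)).hom ≫
    (complexes_shortExact hS N).δ (n + 1) n rfl ≫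
    ((projectiveResolution N).isoLeftDerivedObj
      ((tensoringLeft (ModuleCat.{u} R)).obj S.X₁) n).inv

end TorConnecting

/-! ### Reduction modulo `f` of a presentation -/

namespace ChangeOfRings

variable {T : Type u} [CommRing T] (f : T)

instance (X : Type u) [AddCommGroup X] [Module T X] :
    IsScalarTower T (T ⧸ Ideal.span {f}) (QuotSMulTop f X) where
  smul_assoc t r x := by
    obtain ⟨r, rfl⟩ := Ideal.Quotient.mk_surjective r
    obtain ⟨x, rfl⟩ := Submodule.Quotient.mk_surjective _ x
    exact congrArg (Submodule.Quotient.mk (p := f • (⊤ : Submodule T X))) (mul_smul t r x)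

theorem algebraMap_surjective :
    Function.Surjective (algebraMap T (T ⧸ Ideal.span {f})) := Ideal.Quotient.mk_surjective

theorem smul_eq_zero {M : Type u} [AddCommGroup M] [Module T M] [Module (T ⧸ Ideal.span {f}) M]
    [IsScalarTower T (T ⧸ Ideal.span {f}) M] (m : M) : f • m = 0 := by
  rw [← algebraMap_smul (T ⧸ Ideal.span {f}) f m,
    show algebraMap T (T ⧸ Ideal.span {f}) f = 0 from
      Ideal.Quotient.eq_zero_iff_mem.2 (Ideal.mem_span_singleton_self f), zero_smul]

variable {M : Type u} [AddCommGroup M] [Module T M] [Module (T ⧸ Ideal.span {f}) M]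
  [IsScalarTower T (T ⧸ Ideal.span {f}) M]
  {P : Type u} [AddCommGroup P] [Module T P] (p : P →ₗ[T] M)

/-- For `W = ker p`, the map `P → W / fW`, `x ↦ f x + fW`. -/
def mulMap : P →ₗ[T] QuotSMulTop f (LinearMap.ker p) :=
  (f • (⊤ : Submodule T (LinearMap.ker p))).mkQ ∘ₗ
    (LinearMap.lsmul T P f).codRestrict (LinearMap.ker p) fun x => by
      simp [smul_eq_zero f]

theorem ker_le_ker_mulMap : LinearMap.ker p ≤ LinearMap.ker (mulMap f p) := fun x hx => by
  rw [LinearMap.mem_ker, mulMap, LinearMap.comp_apply, Submodule.mkQ_apply,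
    Submodule.Quotient.mk_eq_zero]
  exact Submodule.smul_mem_pointwise_smul (⟨x, hx⟩ : LinearMap.ker p) f ⊤ trivial

/-- The map `θ : M → W / fW` for a surjection `p : P → M` with kernel `W` (the first syzygy of
`M` over `T`): `θ (p x) = f x + fW`. -/
def theta (hp : Function.Surjective p) :
    M →ₗ[T ⧸ Ideal.span {f}] QuotSMulTop f (LinearMap.ker p) :=
  LinearMap.extendScalarsOfSurjective (algebraMap_surjective f)
    ((LinearMap.ker p).liftQ (mulMap f p) (ker_le_ker_mulMap f p) ∘ₗ
      (p.quotKerEquivOfSurjective hp).symm.toLinearMap)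

theorem theta_apply (hp : Function.Surjective p) (x : P) :
    theta f p hp (p x) = Submodule.Quotient.mk ⟨f • x, by simp [smul_eq_zero f]⟩ := by
  have : (p.quotKerEquivOfSurjective hp).symm (p x) = Submodule.Quotient.mk x := by
    rw [LinearEquiv.symm_apply_eq]; rfl
  change (LinearMap.ker p).liftQ (mulMap f p) (ker_le_ker_mulMap f p) ((p.quotKerEquivOfSurjective hp).symm (p x)) = _
  rw [this]
  rfl

/-- The map `P / fP → M` induced by `p : P → M`. -/
def reduced : QuotSMulTop f P →ₗ[T ⧸ Ideal.span {f}] M :=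
  LinearMap.extendScalarsOfSurjective (algebraMap_surjective f)
    ((f • (⊤ : Submodule T P)).liftQ p (by
      intro x hx
      obtain ⟨y, -, rfl⟩ := (Submodule.mem_smul_pointwise_iff_exists _ _ _).1 hx
      simp [smul_eq_zero f]))

/-- The map `W / fW → P / fP` induced by the inclusion of `W = ker p`. -/
def syzMap : QuotSMulTop f (LinearMap.ker p) →ₗ[T ⧸ Ideal.span {f}] QuotSMulTop f P :=
  LinearMap.extendScalarsOfSurjective (algebraMap_surjective f)
    (QuotSMulTop.map f (LinearMap.ker p).subtype)

/-- `W / fW` maps onto the kernel of `P / fP → M`, the first syzygy of `M` over `T / (f)`. -/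
def toSyz : QuotSMulTop f (LinearMap.ker p) →ₗ[T ⧸ Ideal.span {f}] LinearMap.ker (reduced f p) :=
  (syzMap f p).codRestrict _ fun w => by
    obtain ⟨w, rfl⟩ := Submodule.Quotient.mk_surjective _ w
    exact w.2

/-- The sequence `0 → M → W / fW → ker (P / fP → M) → 0`. -/
def leftSeq (hp : Function.Surjective p) : ShortComplex (ModuleCat.{u} (T ⧸ Ideal.span {f})) :=
  ShortComplex.mk (ModuleCat.ofHom (theta f p hp)) (ModuleCat.ofHom (toSyz f p)) (by
    refine ModuleCat.hom_ext (LinearMap.ext fun m => ?_)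
    obtain ⟨x, rfl⟩ := hp m
    change toSyz f p (theta f p hp (p x)) = 0
    rw [theta_apply]
    apply Subtype.ext
    exact (Submodule.Quotient.mk_eq_zero _).2
      (Submodule.smul_mem_pointwise_smul x f ⊤ trivial))

/-- The sequence `0 → ker (P / fP → M) → P / fP → M → 0`. -/
def rightSeq : ShortComplex (ModuleCat.{u} (T ⧸ Ideal.span {f})) :=
  ShortComplex.mk (ModuleCat.ofHom (LinearMap.ker (reduced f p)).subtype)
    (ModuleCat.ofHom (reduced f p)) (by
      ext x
      exact x.2)

variable {f}

theorem leftSeq_shortExact (hf : IsSMulRegular P f) (hp : Function.Surjective p) :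
    (leftSeq f p hp).ShortExact := by
  refine ShortComplex.ShortExact.mk' ?_ ?_ ?_
  · rw [ShortComplex.ShortExact.moduleCat_exact_iff_function_exact]
    intro w
    refine ⟨fun hw => ?_, ?_⟩
    · obtain ⟨w, rfl⟩ := Submodule.Quotient.mk_surjective _ w
      have h : (Submodule.Quotient.mk (w : P) : QuotSMulTop f P) = 0 := congrArg Subtype.val hw
      obtain ⟨x, -, hx⟩ := (Submodule.mem_smul_pointwise_iff_exists _ _ _).1
        ((Submodule.Quotient.mk_eq_zero _).1 h)
      refine ⟨p x, (theta_apply f p hp x).trans ?_⟩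
      exact congrArg Submodule.Quotient.mk (Subtype.ext hx)
    · rintro ⟨m, rfl⟩
      exact congrArg (fun g => g.hom m) (leftSeq f p hp).zero
  · rw [ModuleCat.mono_iff_injective]
    refine (injective_iff_map_eq_zero (theta f p hp)).2 fun m hm => ?_
    obtain ⟨x, rfl⟩ := hp m
    rw [theta_apply, Submodule.Quotient.mk_eq_zero] at hm
    obtain ⟨w, -, hw⟩ := (Submodule.mem_smul_pointwise_iff_exists _ _ _).1 hm
    have : (w : P) = x := hf (congrArg Subtype.val hw)
    rw [← this]
    exact w.2
  · rw [ModuleCat.epi_iff_surjective]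
    rintro ⟨x, hx⟩
    obtain ⟨x, rfl⟩ := Submodule.Quotient.mk_surjective _ x
    exact ⟨Submodule.Quotient.mk ⟨x, hx⟩, rfl⟩

theorem rightSeq_shortExact (hp : Function.Surjective p) : (rightSeq f p).ShortExact := by
  refine ShortComplex.ShortExact.mk' ?_ ?_ ?_
  · rw [ShortComplex.ShortExact.moduleCat_exact_iff_function_exact]
    intro x
    exact ⟨fun hx => ⟨⟨x, hx⟩, rfl⟩, by rintro ⟨y, rfl⟩; exact y.2⟩
  · rw [ModuleCat.mono_iff_injective]
    exact Subtype.val_injective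
  · rw [ModuleCat.epi_iff_surjective]
    intro m
    obtain ⟨x, rfl⟩ := hp m
    exact ⟨Submodule.Quotient.mk x, rfl⟩

/-- The connecting map `α_i : Tor_{i+2}^R(M, N) → Tor_i^R(M, N)` of the change-of-rings long exact
sequence
`⋯ → Tor_{i+2}^T(M, N) → Tor_{i+2}^R(M, N) → Tor_i^R(M, N) → Tor_{i+1}^T(M, N) → ⋯`
for `R = T / (f)`, with `f` a nonzerodivisor, computed from a projective `T`-module `P` and a
surjection `p : P → M` with kernel `W`.

Write `S = ker (P / fP → M)`. Since `P / fP` is `R`-projective, the connecting maps of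
`0 → S → P / fP → M → 0` identify `Tor_{n+1}^R(M, N)` with `Tor_n^R(S, N)` for `n > 0`. Since `f`
is regular on `W` and `P` is `T`-projective,
`Tor_n^R(W / fW, N) = Tor_n^T(W, N) = Tor_{n+1}^T(M, N)` for `n > 0`. With these identifications
the `Tor` sequence of `0 → M → W / fW → S → 0` is the change-of-rings sequence, and its connecting
map is the composite below. Equivalently, it is the differential `E²_{i+2,0} → E²_{i,1}` of the
spectral sequence `Tor_a^R(Tor_b^T(M, R), N) ⇒ Tor_{a+b}^T(M, N)`, in which
`Tor_0^T(M, R) = Tor_1^T(M, R) = M` and the other rows vanish. -/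
def alpha (hf : f ∈ nonZeroDivisors T) [Module.Projective T P] (hp : Function.Surjective p)
    (N : Type u) [AddCommGroup N] [Module (T ⧸ Ideal.span {f}) N] (i : ℕ) :
    ((Tor (ModuleCat.{u} (T ⧸ Ideal.span {f})) (i + 2)).obj
        (ModuleCat.of (T ⧸ Ideal.span {f}) M)).obj (ModuleCat.of (T ⧸ Ideal.span {f}) N) ⟶
      ((Tor (ModuleCat.{u} (T ⧸ Ideal.span {f})) i).obj
        (ModuleCat.of (T ⧸ Ideal.span {f}) M)).obj (ModuleCat.of (T ⧸ Ideal.span {f}) N) :=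
  TorConnecting.torδ (rightSeq_shortExact (f := f) p hp) (ModuleCat.of _ N) (i + 1) ≫
    TorConnecting.torδ
      (leftSeq_shortExact p (Module.Flat.isSMulRegular_of_nonZeroDivisors hf) hp)
      (ModuleCat.of _ N) i

end ChangeOfRings

end

/-! Write `S = ker (P / fP → M)`. Everything is read off from the exact sequence `0 → M → W / fW → S
→ 0` whose first map is `θ`. If `θ` splits, `M` is a summand of `W / fW`, which lifts to `W`: `f` is
regular on `W`, and by the Koszul resolution of `T / (f)` this is the vanishing of the higher `Tor`.
Conversely, for a lift `L'` the cover `L' → L' / fL'` has kernel `fL'`, on which division by `f`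
inverts `θ`. Since `θ` is natural, the splitting passes to direct summands and to other projective
covers. The map `α_i` ends with the connecting map of this sequence, hence vanishes when `θ` splits.
Conversely, `α₀` is `Tor_2(M, N) → Tor_1(S, N)`, an epimorphism because `P / fP` is flat, followed
by `Tor_1(S, N) → M ⊗ N`. If `α₀` is zero for every finitely generated `N`, then every `θ ⊗ N` is
injective, so `θ` is pure. For a finitely generated cover `S` is finitely presented, and a pure
monomorphism with finitely presented cokernel splits. -/

noncomputable section

open CategoryTheory MonoidalCategory
open scoped Pointwise

/-! ### Pure monomorphisms with finitely presented cokernel -/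

section Purity

variable {R : Type u} [CommRing R]

/-- A pure monomorphism, tested on finitely generated modules, whose cokernel is finitely
presented splits. -/
theorem LinearMap.exists_leftInverse_of_pure {M X S : Type u} [AddCommGroup M] [Module R M]
    [AddCommGroup X] [Module R X] [AddCommGroup S] [Module R S] [Module.FinitePresentation R S]
    (i : M →ₗ[R] X) (g : X →ₗ[R] S) (hi : Function.Injective i) (hg : Function.Surjective g)
    (hig : Function.Exact i g)
    (pure : ∀ (N : Type u) [AddCommGroup N] [Module R N] [Module.Finite R N],
      Function.Injective (i.rTensor N)) :
    ∃ ρ : X →ₗ[R] M, ρ ∘ₗ i = LinearMap.id := by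
  obtain ⟨n, K, e, hK⟩ := Module.FinitePresentation.exists_fin R S
  have : Module.Finite R K := Module.Finite.iff_fg.2 hK
  obtain ⟨m, c, hc⟩ := Module.Finite.exists_fin' R K
  let q : (Fin n → R) →ₗ[R] S := e.symm.toLinearMap ∘ₗ K.mkQ
  let A : (Fin m → R) →ₗ[R] (Fin n → R) := K.subtype ∘ₗ c
  have hqA (x) : q (A x) = 0 := by simp [q, A]
  obtain ⟨v, hv⟩ := Module.projective_lifting_property g q hg
  replace hv (x) : g (v x) = q x := LinearMap.congr_fun hv x
  let M' := LinearMap.range i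
  -- `v` sends relations into the image of `i`, and `w` records their values in `M`. Once some `u`
  -- satisfies `u ∘ A = w`, the difference `v - i ∘ u` kills `K` and descends to a section of `g`.
  obtain ⟨w, hw⟩ := Module.projective_lifting_property i.rangeRestrict
    ((v ∘ₗ A).codRestrict M' fun x => (hig _).1 (by simp [hv, hqA])) i.surjective_rangeRestrict
  replace hw (x) : i (w x) = v (A x) := congrArg Subtype.val (LinearMap.congr_fun hw x)
  -- the transpose of the relation matrix and its cokernel
  let B : (Fin n → R) →ₗ[R] (Fin m → R) := (LinearMap.toMatrix' A).transpose.mulVecLin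
  let N := (Fin m → R) ⧸ LinearMap.range B
  -- `u ∘ A = w` is a linear system over `M` in the values of `u` on the basis; it is solvable
  -- exactly when `t` lies in the image of `M ⊗ B`.
  let t : TensorProduct R M (Fin m → R) := ∑ k, w (Pi.single k 1) ⊗ₜ Pi.single k 1
  have hA (k : Fin m) : A (Pi.single k 1) =
      ∑ j, LinearMap.toMatrix' A j k • (Pi.single j 1 : Fin n → R) := by
    ext l
    simp [LinearMap.toMatrix'_apply, Finset.sum_apply, Pi.single_apply]
  have hB (j : Fin n) : B (Pi.single j 1) =
      ∑ k, LinearMap.toMatrix' A j k • (Pi.single k 1 : Fin m → R) := by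
    ext l
    simp [B, Finset.sum_apply, Pi.single_apply]
  have ht : (LinearMap.range B).mkQ.lTensor M t = 0 := by
    -- In `X` the system has the solution `v`, so the image of `t` is a sum of terms `v e_j ⊗ B
    -- e_j`, which vanish in `X ⊗ N`.
    apply pure N
    simp only [t, map_sum, LinearMap.lTensor_tmul, LinearMap.rTensor_tmul, hw, hA, map_smul,
      map_zero, TensorProduct.sum_tmul, TensorProduct.smul_tmul]
    rw [Finset.sum_comm]
    refine Finset.sum_eq_zero fun j _ => ?_
    rw [← TensorProduct.tmul_sum]
    simp only [← map_smul, ← map_sum, ← hB]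
    rw [show (LinearMap.range B).mkQ (B (Pi.single j 1)) = 0 from
      (Submodule.Quotient.mk_eq_zero _).2 (LinearMap.mem_range_self B _), TensorProduct.tmul_zero]
  obtain ⟨y, hy⟩ := (lTensor_exact M (f := B) (LinearMap.exact_map_mkQ_range B)
    (Submodule.mkQ_surjective _) t).1 ht
  let z := TensorProduct.piScalarRight R R M (Fin n) y
  have hz (k : Fin m) : ∑ j, LinearMap.toMatrix' A j k • z j = w (Pi.single k 1) := by
    have h1 : TensorProduct.piScalarRight R R M (Fin m) t k = w (Pi.single k 1) := by
      simp [t, Finset.sum_apply, Pi.single_apply, TensorProduct.piScalarRightHom_tmul]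
    rw [← h1, ← hy]
    simp only [z]
    clear_value z
    clear hy h1
    induction y with
    | zero => simp
    | tmul a x =>
      simp [TensorProduct.piScalarRightHom_tmul, B, Matrix.vecMul, dotProduct, Finset.sum_smul,
        smul_smul, mul_comm]
    | add y₁ y₂ h₁ h₂ => simp only [map_add, Pi.add_apply, smul_add, Finset.sum_add_distrib, h₁, h₂]
  let u : (Fin n → R) →ₗ[R] M := Fintype.linearCombination R z
  have hu : u ∘ₗ A = w := by
    refine (Pi.basisFun R (Fin m)).ext fun k => ?_
    simp only [LinearMap.comp_apply, Pi.basisFun_apply, hA, map_sum, map_smul, u]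
    simp [← hz]
  have hgi (x) : g (i x) = 0 := (hig _).2 ⟨x, rfl⟩
  let s' : (Fin n → R) ⧸ K →ₗ[R] X := K.liftQ (v - i ∘ₗ u) fun x hx => by
    obtain ⟨y, hy⟩ := hc ⟨x, hx⟩
    have : x = A y := by simp [A, hy]
    have huy : u (A y) = w y := LinearMap.congr_fun hu y
    rw [this, LinearMap.mem_ker, LinearMap.sub_apply, LinearMap.comp_apply i, huy, hw, sub_self]
  have hs : g ∘ₗ (s' ∘ₗ e.toLinearMap) = LinearMap.id := by
    ext x
    obtain ⟨x, rfl⟩ := e.symm.surjective x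
    obtain ⟨x, rfl⟩ := Submodule.Quotient.mk_surjective _ x
    simp [s', hv, hgi, q]
  exact (((Function.Exact.split_tfae' hig).out 0 1 rfl rfl).1 ⟨hi, _, hs⟩).2

end Purity

/-! ### Naturality of `θ` and its splitting on reductions -/

namespace ChangeOfRings

variable {T : Type u} [CommRing T] (f : T)

section Comparison

variable {M : Type u} [AddCommGroup M] [Module T M] [Module (T ⧸ Ideal.span {f}) M]
  [IsScalarTower T (T ⧸ Ideal.span {f}) M]
  {P : Type u} [AddCommGroup P] [Module T P] (p : P →ₗ[T] M) (hp : Function.Surjective p)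
  {M' : Type u} [AddCommGroup M'] [Module T M'] [Module (T ⧸ Ideal.span {f}) M']
  [IsScalarTower T (T ⧸ Ideal.span {f}) M']
  {P' : Type u} [AddCommGroup P'] [Module T P'] (p' : P' →ₗ[T] M') (hp' : Function.Surjective p')

/-- `θ` is natural in the module and its cover. -/
theorem exists_comp_theta [Module.Projective T P] (j : M →ₗ[T ⧸ Ideal.span {f}] M') :
    ∃ g : QuotSMulTop f (LinearMap.ker p) →ₗ[T ⧸ Ideal.span {f}]
        QuotSMulTop f (LinearMap.ker p'),
      g ∘ₗ theta f p hp = theta f p' hp' ∘ₗ j := by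
  obtain ⟨φ, hφ⟩ := Module.projective_lifting_property p' (j.restrictScalars T ∘ₗ p) hp'
  replace hφ (x) : p' (φ x) = j (p x) := LinearMap.congr_fun hφ x
  let φ' : LinearMap.ker p →ₗ[T] LinearMap.ker p' := φ.restrict fun x hx => by
    rw [LinearMap.mem_ker, hφ, LinearMap.mem_ker.1 hx, map_zero]
  refine ⟨LinearMap.extendScalarsOfSurjective (algebraMap_surjective f) (QuotSMulTop.map f φ'), ?_⟩
  ext m
  obtain ⟨x, rfl⟩ := hp m
  rw [LinearMap.comp_apply, LinearMap.comp_apply, ← hφ, theta_apply, theta_apply]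
  exact congrArg Submodule.Quotient.mk (Subtype.ext (map_smul φ f x))

/-- If `M` is a direct summand of `M'` and `θ` splits for `M'`, then it splits for `M`. -/
theorem theta_split_of_retract [Module.Projective T P] (j : M →ₗ[T ⧸ Ideal.span {f}] M')
    (q : M' →ₗ[T ⧸ Ideal.span {f}] M) (hqj : q ∘ₗ j = LinearMap.id)
    (h : ∃ ρ : QuotSMulTop f (LinearMap.ker p') →ₗ[T ⧸ Ideal.span {f}] M',
      ρ ∘ₗ theta f p' hp' = LinearMap.id) :
    ∃ ρ : QuotSMulTop f (LinearMap.ker p) →ₗ[T ⧸ Ideal.span {f}] M,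
      ρ ∘ₗ theta f p hp = LinearMap.id := by
  obtain ⟨ρ, hρ⟩ := h
  obtain ⟨g, hg⟩ := exists_comp_theta f p hp p' hp' j
  refine ⟨q ∘ₗ ρ ∘ₗ g, ?_⟩
  rw [LinearMap.comp_assoc, LinearMap.comp_assoc, hg, ← LinearMap.comp_assoc j, hρ,
    LinearMap.id_comp, hqj]

end Comparison

/-- `θ` splits for the reduction `L / fL` of a module on which `f` is regular. -/
theorem theta_mkQ_split {L : Type u} [AddCommGroup L] [Module T L] (hf : IsSMulRegular L f) :
    ∃ ρ : QuotSMulTop f (LinearMap.ker (f • (⊤ : Submodule T L)).mkQ) →ₗ[T ⧸ Ideal.span {f}]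
        QuotSMulTop f L,
      ρ ∘ₗ theta f (M := QuotSMulTop f L) (f • (⊤ : Submodule T L)).mkQ
        (Submodule.mkQ_surjective _) = LinearMap.id := by
  -- The kernel of `L → L / fL` is `fL`; the retraction is division by `f`, well defined by
  -- regularity.
  let e := LinearEquiv.ofInjective (LinearMap.lsmul T L f) hf
  let h : LinearMap.ker (f • (⊤ : Submodule T L)).mkQ →ₗ[T] L := e.symm.toLinearMap ∘ₗ
    Submodule.inclusion (by
      rw [Submodule.ker_mkQ]
      intro x hx
      obtain ⟨y, -, rfl⟩ := (Submodule.mem_smul_pointwise_iff_exists _ _ _).1 hx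
      exact ⟨y, rfl⟩)
  have hh (x : L) (hx) : h ⟨f • x, hx⟩ = x := by
    rw [LinearMap.comp_apply, LinearEquiv.coe_coe, LinearEquiv.symm_apply_eq]
    rfl
  refine ⟨LinearMap.extendScalarsOfSurjective (algebraMap_surjective f) (QuotSMulTop.map f h), ?_⟩
  refine LinearMap.ext fun m => ?_
  obtain ⟨x, rfl⟩ := Submodule.mkQ_surjective _ m
  rw [LinearMap.comp_apply, theta_apply]
  exact congrArg Submodule.Quotient.mk (hh x _)

/-- `L / fL` is the base change of `L` to `T / (f)`. -/
def baseChangeEquiv (L : Type u) [AddCommGroup L] [Module T L] :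
    TensorProduct T (T ⧸ Ideal.span {f}) L ≃ₗ[T ⧸ Ideal.span {f}] QuotSMulTop f L :=
  LinearEquiv.extendScalarsOfSurjective (algebraMap_surjective f)
    (QuotSMulTop.equivQuotTensor f L).symm

end ChangeOfRings

/-! ### Right exact functors and homology in degree zero -/

section Category

variable {C : Type*} [Category* C]

theorem CategoryTheory.Iso.hom_comp_comp_inv_eq_zero_iff [Limits.HasZeroMorphisms C]
    {A A' B B' : C} (e : A ≅ A') (e' : B ≅ B') (δ : A' ⟶ B') :
    e.hom ≫ δ ≫ e'.inv = 0 ↔ δ = 0 := by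
  refine ⟨fun h => ?_, fun h => by rw [h, Limits.zero_comp, Limits.comp_zero]⟩
  rw [← cancel_epi e.hom, ← cancel_mono e'.inv, Category.assoc, h, Limits.comp_zero,
    Limits.zero_comp]

theorem CategoryTheory.Iso.epi_hom_comp_comp_inv {A A' B B' : C} (e : A ≅ A') (e' : B ≅ B')
    (δ : A' ⟶ B') (_ : Epi δ) : Epi (e.hom ≫ δ ≫ e'.inv) :=
  inferInstance

variable {D : Type*} [Category* D] [Abelian C] [Abelian D]

/-- If a natural transformation of right exact functors is a monomorphism on the zeroth homology
of a projective resolution of `X`, then it is a monomorphism at `X`. -/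
theorem CategoryTheory.ProjectiveResolution.mono_app_of_mono_homologyMap {F G : C ⥤ D}
    [F.Additive] [G.Additive] [Limits.PreservesFiniteColimits F]
    [Limits.PreservesFiniteColimits G] (α : F ⟶ G) {X : C} (Q : ProjectiveResolution X)
    (h : Mono (HomologicalComplex.homologyMap
      ((NatTrans.mapHomologicalComplex α (ComplexShape.down ℕ)).app Q.complex) 0)) :
    Mono (α.app X) := by
  let φ := (NatTrans.mapHomologicalComplex α (ComplexShape.down ℕ)).app Q.complex
  -- In degree `0` homology is all of the opcycles, and right exactness identifies these with the
  -- value of the functor at `X`.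
  have h1 : Mono (HomologicalComplex.opcyclesMap φ 0) := by
    have hφ := ChainComplex.isoHomologyι₀_inv_naturality φ
    have : Mono (HomologicalComplex.homologyMap φ 0) := h
    exact mono_of_mono_fac hφ.symm
  have h2 : HomologicalComplex.opcyclesMap φ 0 ≫ Q.fromLeftDerivedZero' G =
      Q.fromLeftDerivedZero' F ≫ α.app X := by
    rw [← cancel_epi (HomologicalComplex.pOpcycles _ _), HomologicalComplex.p_opcyclesMap_assoc,
      ProjectiveResolution.pOpcycles_comp_fromLeftDerivedZero',
      ProjectiveResolution.pOpcycles_comp_fromLeftDerivedZero'_assoc]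
    exact (α.naturality (Q.π.f 0)).symm
  rw [← IsIso.inv_comp_eq] at h2
  rw [← h2]
  infer_instance

end Category

/-! ### Vanishing and surjectivity of connecting maps -/

namespace TorConnecting

variable {R : Type u} [CommRing R]

/-- By exactness at `Tor_n(X₁, N)`, the image of the connecting map is the kernel of the next map.
-/
theorem torδ_eq_zero_iff {S : ShortComplex (ModuleCat.{u} R)} (hS : S.ShortExact)
    (N : ModuleCat.{u} R) (n : ℕ) :
    torδ hS N n = 0 ↔ Mono (HomologicalComplex.homologyMap (complexes S N).f n) := by
  have h : torδ hS N n = 0 ↔ (complexes_shortExact hS N).δ (n + 1) n rfl = 0 :=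
    Iso.hom_comp_comp_inv_eq_zero_iff _ _ _
  rw [h]
  exact ((complexes_shortExact hS N).homology_exact₁ (n + 1) n rfl).mono_g_iff.symm

/-- The connecting maps of a split short exact sequence vanish. -/
theorem torδ_eq_zero_of_comp_eq_id {S : ShortComplex (ModuleCat.{u} R)} (hS : S.ShortExact)
    (N : ModuleCat.{u} R) (n : ℕ) (r : S.X₂ ⟶ S.X₁) (hr : S.f ≫ r = 𝟙 _) : torδ hS N n = 0 := by
  rw [torδ_eq_zero_iff]
  let ψ : (complexes S N).X₂ ⟶ (complexes S N).X₁ :=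
    (NatTrans.mapHomologicalComplex ((tensoringLeft (ModuleCat.{u} R)).map r) _).app _
  have hψ : (complexes S N).f ≫ ψ = 𝟙 _ := by
    ext n : 1
    change (S.f ▷ _) ≫ (r ▷ _) = 𝟙 _
    rw [← comp_whiskerRight, hr, id_whiskerRight]
  have : HomologicalComplex.homologyMap (complexes S N).f n ≫
      HomologicalComplex.homologyMap ψ n = 𝟙 _ := by
    rw [← HomologicalComplex.homologyMap_comp, hψ, HomologicalComplex.homologyMap_id]
  exact (SplitMono.mk _ this).mono

/-- The connecting map `Tor_{n+2}(X₃, N) → Tor_{n+1}(X₁, N)` is an epimorphism if the middle term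
is flat. -/
theorem epi_torδ_succ {S : ShortComplex (ModuleCat.{u} R)} (hS : S.ShortExact)
    [Module.Flat R S.X₂] (N : ModuleCat.{u} R) (n : ℕ) : Epi (torδ hS N (n + 1)) := by
  -- This is `Tor_{n+1}(X₂, N) = 0`; it fails in degree `0`, hence the shift in the statement.
  have h0 : ((complexes S N).X₂).ExactAt (n + 1) := by
    rw [HomologicalComplex.exactAt_iff' _ (n + 2) (n + 1) n (by simp) (by simp)]
    have h := (projectiveResolution N).exact_succ n
    rw [ShortComplex.ShortExact.moduleCat_exact_iff_function_exact] at h ⊢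
    exact Module.Flat.lTensor_exact S.X₂ h
  have : Epi ((complexes_shortExact hS N).δ (n + 1 + 1) (n + 1) rfl) := by
    refine ((complexes_shortExact hS N).homology_exact₁ _ _ rfl).epi_f ?_
    exact h0.isZero_homology.eq_of_tgt _ _
  exact Iso.epi_hom_comp_comp_inv _ _ _ this

/-- If the connecting map `Tor_1(X₃, N) → Tor_0(X₁, N)` vanishes, then `X₁ ⊗ N → X₂ ⊗ N` is
injective. -/
theorem rTensor_injective_of_torδ_zero {S : ShortComplex (ModuleCat.{u} R)} (hS : S.ShortExact)
    (N : ModuleCat.{u} R) (h : torδ hS N 0 = 0) :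
    Function.Injective (S.f.hom.rTensor N) := by
  rw [torδ_eq_zero_iff] at h
  have hF (X : ModuleCat.{u} R) : Limits.PreservesFiniteColimits
      ((tensoringLeft (ModuleCat.{u} R)).obj X) :=
    inferInstanceAs (Limits.PreservesFiniteColimits (tensorLeft X))
  exact (ModuleCat.mono_iff_injective _).1
    ((projectiveResolution N).mono_app_of_mono_homologyMap
      ((tensoringLeft (ModuleCat.{u} R)).map S.f) h)

end TorConnecting

/-! ### The Koszul resolution of `T / (f)` and regularity -/

namespace ChangeOfRings

variable {T : Type u} [CommRing T] {f : T}

section Koszul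

variable (f)

/-- The objects of the complex `⋯ → 0 → T → T`. -/
def koszulX : ℕ → ModuleCat.{u} T
  | 0 => ModuleCat.of T T
  | 1 => ModuleCat.of T T
  | _ + 2 => ModuleCat.of T PUnit

/-- Multiplication by `f` in degree `1`, and zero above. -/
def koszulD : ∀ n : ℕ, koszulX (T := T) (n + 1) ⟶ koszulX n
  | 0 => ModuleCat.ofHom (LinearMap.lsmul T T f)
  | _ + 1 => 0

/-- The complex `⋯ → 0 → T → T` whose differential is multiplication by `f`. -/
def koszul : ChainComplex (ModuleCat.{u} T) ℕ :=
  ChainComplex.of koszulX (koszulD f) fun n => by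
    cases n <;> exact Limits.zero_comp

theorem koszul_d (n : ℕ) : (koszul f).d (n + 1) n = koszulD f n := ChainComplex.of_d _ _ _

theorem isZero_koszul_X (n : ℕ) : Limits.IsZero ((koszul f).X (n + 2)) :=
  ModuleCat.isZero_of_subsingleton (ModuleCat.of T PUnit)

/-- The augmentation of the Koszul complex to `T / (f)`. -/
def koszulπ : koszul f ⟶
    (ChainComplex.single₀ _).obj (ModuleCat.of T (T ⧸ Ideal.span {f})) :=
  (ChainComplex.toSingle₀Equiv (koszul f) _).symm
    ⟨ModuleCat.ofHom (Ideal.span {f}).mkQ, by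
      rw [koszul_d]
      refine ModuleCat.hom_ext (LinearMap.ext fun (x : T) => ?_)
      exact (Submodule.Quotient.mk_eq_zero _).2
        (Ideal.mul_mem_right x _ (Ideal.mem_span_singleton_self f))⟩

variable {f}

theorem quasiIso_koszulπ (hf : f ∈ nonZeroDivisors T) : QuasiIso (koszulπ f) where
  quasiIsoAt m := by
    match m with
    | 0 =>
      rw [ChainComplex.quasiIsoAt₀_iff, ShortComplex.quasiIso_iff_of_zeros' _ rfl rfl rfl]
      constructor
      · rw [ShortComplex.ShortExact.moduleCat_exact_iff_function_exact]
        change Function.Exact ((koszul f).d 1 0) (Ideal.span {f}).mkQ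
        rw [koszul_d]
        intro (x : T)
        refine (Submodule.Quotient.mk_eq_zero _).trans ?_
        rw [Ideal.mem_span_singleton']
        exact exists_congr fun y => by rw [mul_comm]; rfl
      · rw [ModuleCat.epi_iff_surjective]
        exact Submodule.mkQ_surjective _
    | 1 =>
      rw [quasiIsoAt_iff_exactAt' (hL := ChainComplex.exactAt_succ_single_obj ..),
        HomologicalComplex.exactAt_iff' _ 2 1 0 (by simp) (by simp),
        ShortComplex.ShortExact.moduleCat_exact_iff_function_exact]
      change Function.Exact ((koszul f).d 2 1) ((koszul f).d 1 0)
      rw [koszul_d, koszul_d]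
      intro (x : T)
      refine ⟨fun hx => ⟨PUnit.unit, ?_⟩, ?_⟩
      · exact ((mul_left_mem_nonZeroDivisors_eq_zero_iff hf).1 hx).symm
      · rintro ⟨y, rfl⟩
        exact map_zero (LinearMap.lsmul T T f)
    | m + 2 =>
      rw [quasiIsoAt_iff_exactAt' (hL := ChainComplex.exactAt_succ_single_obj ..)]
      exact HomologicalComplex.ExactAt.of_isZero (isZero_koszul_X f m)

/-- The free resolution `0 → T → T` of `T / (f)`. -/
def koszulResolution (hf : f ∈ nonZeroDivisors T) :
    ProjectiveResolution (ModuleCat.of T (T ⧸ Ideal.span {f})) where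
  complex := koszul f
  projective n := by
    match n with
    | 0 | 1 => exact (IsProjective.iff_projective T).1 (inferInstance : Module.Projective T T)
    | n + 2 => exact (isZero_koszul_X f n).projective
  π := koszulπ f
  quasiIso := quasiIso_koszulπ hf

/-- Nothing enters from degree `2`, so exactness means that `L ⊗ f`, which is multiplication by `f`
on `L`, is injective. -/
theorem tensor_koszul_exactAt_one_iff (L : Type u) [AddCommGroup L] [Module T L] :
    ((((tensoringLeft (ModuleCat.{u} T)).obj (ModuleCat.of T L)).mapHomologicalComplex
      (ComplexShape.down ℕ)).obj (koszul f)).ExactAt 1 ↔ IsSMulRegular L f := by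
  rw [HomologicalComplex.exactAt_iff' _ 2 1 0 (by simp) (by simp),
    ShortComplex.ShortExact.moduleCat_exact_iff_function_exact]
  change Function.Exact (((koszul f).d 2 1).hom.lTensor L) (((koszul f).d 1 0).hom.lTensor L) ↔ _
  rw [koszul_d, koszul_d]
  change Function.Exact ((0 : PUnit.{u + 1} →ₗ[T] T).lTensor L) ((LinearMap.lsmul T T f).lTensor L) ↔ _
  have h : (TensorProduct.rid T L).toLinearMap ∘ₗ (LinearMap.lsmul T T f).lTensor L =
      LinearMap.lsmul T L f ∘ₗ (TensorProduct.rid T L).toLinearMap :=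
    TensorProduct.ext' fun x t => by simp [mul_smul, smul_comm f t x]
  have h' : IsSMulRegular L f ↔ Function.Injective ((LinearMap.lsmul T T f).lTensor L) := by
    rw [← (TensorProduct.rid T L).injective.of_comp_iff]
    change _ ↔ Function.Injective ((TensorProduct.rid T L).toLinearMap ∘ₗ
      (LinearMap.lsmul T T f).lTensor L)
    rw [h, LinearMap.coe_comp, LinearEquiv.coe_coe, EquivLike.injective_comp]
    rfl
  rw [h', LinearMap.lTensor_zero]
  exact LinearMap.exact_zero_iff_injective _ _

/-- For a nonzerodivisor `f`, the higher `Tor` modules of `L` with `T / (f)` vanish if and only if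
`f` is regular on `L`. -/
theorem isZero_tor_iff_isSMulRegular (hf : f ∈ nonZeroDivisors T) (L : Type u) [AddCommGroup L]
    [Module T L] :
    (∀ i : ℕ, 0 < i → Limits.IsZero (((Tor (ModuleCat.{u} T) i).obj (ModuleCat.of T L)).obj
      (ModuleCat.of T (T ⧸ Ideal.span {f})))) ↔ IsSMulRegular L f := by
  let F := (tensoringLeft (ModuleCat.{u} T)).obj (ModuleCat.of T L)
  have h (i : ℕ) : Limits.IsZero (((Tor (ModuleCat.{u} T) i).obj (ModuleCat.of T L)).obj
      (ModuleCat.of T (T ⧸ Ideal.span {f}))) ↔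
      ((F.mapHomologicalComplex (ComplexShape.down ℕ)).obj (koszul f)).ExactAt i := by
    rw [HomologicalComplex.exactAt_iff_isZero_homology]
    exact ((koszulResolution hf).isoLeftDerivedObj F i).isZero_iff
  refine ⟨fun H => (tensor_koszul_exactAt_one_iff L).1 ((h 1).1 (H 1 one_pos)), fun H i hi => ?_⟩
  rw [h]
  match i, hi with
  | 1, _ => exact (tensor_koszul_exactAt_one_iff L).2 H
  | i + 2, _ => exact HomologicalComplex.ExactAt.of_isZero (F.map_isZero (isZero_koszul_X f i))

end Koszul

end ChangeOfRings

/-! ### Weak liftability, splitting of `θ` and vanishing of `α` -/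

namespace ChangeOfRings

variable {T : Type u} [CommRing T] (f : T)
  {M : Type u} [AddCommGroup M] [Module T M] [Module (T ⧸ Ideal.span {f}) M]
  [IsScalarTower T (T ⧸ Ideal.span {f}) M]
  {P : Type u} [AddCommGroup P] [Module T P] (p : P →ₗ[T] M) (hp : Function.Surjective p)

variable {f}

/-- `θ` splits for every cover of a weakly liftable module. -/
theorem theta_split_of_isWeaklyLiftable (hf : f ∈ nonZeroDivisors T) [Module.Projective T P]
    (h : IsWeaklyLiftable T (T ⧸ Ideal.span {f}) M) :
    ∃ ρ : QuotSMulTop f (LinearMap.ker p) →ₗ[T ⧸ Ideal.span {f}] M,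
      ρ ∘ₗ theta f p hp = LinearMap.id := by
  obtain ⟨L, _, _, -, ⟨L', _, _, -, ⟨e⟩, hL'⟩, j, q, hqj⟩ := h
  let e' := (baseChangeEquiv f L').symm.trans e
  -- The lift `L'` itself covers `L' / fL'`. It need not be projective: naturality only lifts maps
  -- out of the cover `P` of the summand.
  refine theta_split_of_retract f p hp _ (Submodule.mkQ_surjective _)
    (e'.symm.toLinearMap ∘ₗ j) (q ∘ₗ e'.toLinearMap) ?_
    (theta_mkQ_split f ((isZero_tor_iff_isSMulRegular hf L').1 hL'))
  ext m
  simpa using LinearMap.congr_fun hqj m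

/-- If `θ` splits for a finitely generated submodule of a module on which `f` is regular, then
`M` is weakly liftable. -/
theorem isWeaklyLiftable_of_theta_split (hf : f ∈ nonZeroDivisors T) [Module.Flat T P]
    [Module.Finite T (LinearMap.ker p)]
    (h : ∃ ρ : QuotSMulTop f (LinearMap.ker p) →ₗ[T ⧸ Ideal.span {f}] M,
      ρ ∘ₗ theta f p hp = LinearMap.id) :
    IsWeaklyLiftable T (T ⧸ Ideal.span {f}) M := by
  obtain ⟨ρ, hρ⟩ := h
  have : Module.Finite (T ⧸ Ideal.span {f}) (QuotSMulTop f (LinearMap.ker p)) :=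
    Module.Finite.of_restrictScalars_finite T _ _
  refine ⟨QuotSMulTop f (LinearMap.ker p), inferInstance, inferInstance, this,
    ⟨LinearMap.ker p, inferInstance, inferInstance, inferInstance,
      ⟨baseChangeEquiv f _⟩, (isZero_tor_iff_isSMulRegular hf _).2 ?_⟩, _, ρ, hρ⟩
  exact (Module.Flat.isSMulRegular_of_nonZeroDivisors hf).submodule _ _

theorem alpha_eq_zero_of_theta_split (hf : f ∈ nonZeroDivisors T) [Module.Projective T P]
    (h : ∃ ρ : QuotSMulTop f (LinearMap.ker p) →ₗ[T ⧸ Ideal.span {f}] M,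
      ρ ∘ₗ theta f p hp = LinearMap.id)
    (N : Type u) [AddCommGroup N] [Module (T ⧸ Ideal.span {f}) N] (i : ℕ) :
    alpha p hf hp N i = 0 := by
  obtain ⟨ρ, hρ⟩ := h
  have hS := leftSeq_shortExact p (Module.Flat.isSMulRegular_of_nonZeroDivisors hf) hp
  rw [alpha, TorConnecting.torδ_eq_zero_of_comp_eq_id hS _ _ (ModuleCat.ofHom ρ)
    (ModuleCat.hom_ext hρ)]
  exact Limits.comp_zero

theorem flat_quotSMulTop [Module.Flat T P] :
    Module.Flat (T ⧸ Ideal.span {f}) (QuotSMulTop f P) :=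
  Module.Flat.of_linearEquiv (baseChangeEquiv f P).symm

/-- If `α₀` vanishes for `N`, then `θ ⊗ N` is injective. -/
theorem rTensor_theta_injective (hf : f ∈ nonZeroDivisors T) [Module.Projective T P]
    (N : Type u) [AddCommGroup N] [Module (T ⧸ Ideal.span {f}) N]
    (h : alpha p hf hp N 0 = 0) : Function.Injective ((theta f p hp).rTensor N) := by
  have : Module.Flat (T ⧸ Ideal.span {f}) (rightSeq f p).X₂ := flat_quotSMulTop (f := f) (P := P)
  have := TorConnecting.epi_torδ_succ (rightSeq_shortExact (f := f) p hp)
    (ModuleCat.of _ N) 0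
  refine TorConnecting.rTensor_injective_of_torδ_zero
    (leftSeq_shortExact p (Module.Flat.isSMulRegular_of_nonZeroDivisors hf) hp)
    (ModuleCat.of _ N) ?_
  exact (cancel_epi (TorConnecting.torδ (rightSeq_shortExact (f := f) p hp)
    (ModuleCat.of _ N) (0 + 1))).1 (h.trans Limits.comp_zero.symm)

/-- If `θ` is a pure monomorphism for one projective cover, then it splits for every finitely
generated one. -/
theorem theta_split_of_pure [IsNoetherianRing T] (hf : f ∈ nonZeroDivisors T)
    [Module.Projective T P] [Module.Finite T P]
    {P' : Type u} [AddCommGroup P'] [Module T P'] (p' : P' →ₗ[T] M) (hp' : Function.Surjective p')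
    (pure : ∀ (N : Type u) [AddCommGroup N] [Module (T ⧸ Ideal.span {f}) N]
      [Module.Finite (T ⧸ Ideal.span {f}) N], Function.Injective ((theta f p' hp').rTensor N)) :
    ∃ ρ : QuotSMulTop f (LinearMap.ker p) →ₗ[T ⧸ Ideal.span {f}] M,
      ρ ∘ₗ theta f p hp = LinearMap.id := by
  -- `P'` may be infinitely generated, so purity is moved to the finite cover `p`: `θ` for `p'`
  -- factors through `θ` for `p`, and a first factor of an injective map is injective.
  obtain ⟨g, hg⟩ := exists_comp_theta f p hp p' hp' LinearMap.id
  have : Module.Finite (T ⧸ Ideal.span {f}) (QuotSMulTop f P) :=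
    Module.Finite.of_restrictScalars_finite T _ _
  have : Module.FinitePresentation (T ⧸ Ideal.span {f}) (LinearMap.ker (reduced f p)) :=
    Module.finitePresentation_of_finite _ _
  have hS := leftSeq_shortExact p (Module.Flat.isSMulRegular_of_nonZeroDivisors hf) hp
  refine LinearMap.exists_leftInverse_of_pure (theta f p hp) (toSyz f p)
    ((ModuleCat.mono_iff_injective _).1 hS.mono_f) ((ModuleCat.epi_iff_surjective _).1 hS.epi_g)
    ((ShortComplex.ShortExact.moduleCat_exact_iff_function_exact _).1 hS.exact) ?_
  intro N _ _ _
  have hN := pure N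
  rw [← (theta f p' hp').comp_id, ← hg, LinearMap.rTensor_comp, LinearMap.coe_comp] at hN
  exact hN.of_comp

end ChangeOfRings

end

theorem proposition3p1 {Λ : Type*} [CommRing Λ] [IsLocalRing Λ]
    {T : Type u} [CommRing T] [IsNoetherianRing T] [Algebra Λ T]
    (f : T) (hf : f ∈ nonZeroDivisors T)
    (M : Type u) [AddCommGroup M] [Module T M] [Module (T ⧸ Ideal.span {f}) M]
    [IsScalarTower T (T ⧸ Ideal.span {f}) M] [Module.Finite (T ⧸ Ideal.span {f}) M]
    -- the free cover that defines the first syzygy of `M` over `T`, the kernel of `π`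
    {a : ℕ} (π : (Fin a → T) →ₗ[T] M) (hπ : Function.Surjective π)
    -- a projective cover from which the connecting maps are computed
    {P : Type u} [AddCommGroup P] [Module T P] [Module.Projective T P]
    (p : P →ₗ[T] M) (hp : Function.Surjective p) :
    List.TFAE [
      IsWeaklyLiftable T (T ⧸ Ideal.span {f}) M,
      ∃ ρ : QuotSMulTop f (LinearMap.ker π) →ₗ[T ⧸ Ideal.span {f}] M,
        ρ ∘ₗ ChangeOfRings.theta f π hπ = LinearMap.id,
      ∀ (N : Type u) [AddCommGroup N] [Module (T ⧸ Ideal.span {f}) N]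
        [Module.Finite (T ⧸ Ideal.span {f}) N],
        ChangeOfRings.alpha p hf hp N 0 = 0,
      ∀ (N : Type u) [AddCommGroup N] [Module (T ⧸ Ideal.span {f}) N]
        [Module.Finite (T ⧸ Ideal.span {f}) N] (i : ℕ),
        ChangeOfRings.alpha p hf hp N i = 0] := by
  tfae_have 1 → 2 := ChangeOfRings.theta_split_of_isWeaklyLiftable π hπ hf
  tfae_have 2 → 1 := ChangeOfRings.isWeaklyLiftable_of_theta_split π hπ hf
  -- The splitting is carried from `π` to `p` by viewing `M` as a retract of itself.
  tfae_have 2 → 4 := fun h N _ _ _ i =>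
    ChangeOfRings.alpha_eq_zero_of_theta_split p hp hf
      (ChangeOfRings.theta_split_of_retract f p hp π hπ LinearMap.id LinearMap.id rfl h) N i
  tfae_have 4 → 3 := fun h N _ _ _ => h N 0
  tfae_have 3 → 2 := fun h => ChangeOfRings.theta_split_of_pure π hπ hf p hp fun N _ _ _ =>
    ChangeOfRings.rTensor_theta_injective p hp hf N (h N)
  tfae_finish
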